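/- Let $X$ be a measurable space with $\sigma$-algebra $\mathcal O(X)$, and let $\mathcal H_1,\mathcal H_2$ be separable complex Hilbert spaces, with inner products linear in the second variable. A spectral measure on $X$ with values in $\mathcal B(\mathcal H)$ is a map $\pi:\mathcal O(X)\to\mathcal B(\mathcal H)$ such that every $\pi(A)$ is an orthogonal projection, $\pi(X)=I_{\mathcal H}$, and $A\mapsto\langle h,\pi(A)k\rangle$ is a complex measure for all $h,k\in\mathcal H$. If $\mathcal K\subseteq\mathcal H$ is a closed subspace invariant under all $\pi(A)$, the spectral measure $A\mapsto\pi(A)|_{\mathcal K}$ is called a sub-spectral measure of $\pi$; it is non-zero if $\mathcal K\neq\{0\}$. Two spectral measures $\rho_i:\mathcal O(X)\to\mathcal B(\mathcal K_i)$, $i=1,2$, are unitarily equivalent if there is a unitary $U:\mathcal K_1\to\mathcal K_2$ with $U\rho_1(A)=\rho_2(A)U$ for all $A\in\mathcal O(X)$. Let $\pi_i:\mathcal O(X)\to\mathcal B(\mathcal H_i)$, $i=1,2$, be two spectral measures. Then the following are equivalent: 1. $\pi_1$ and $\pi_2$ are mutually singular, i.e. there exist disjoint sets $X_1,X_2\in\mathcal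 O(X)$ such that $\pi_i(A)=\pi_i(A\cap X_i)$ for all $A\in\mathcal O(X)$ and $i=1,2$. 2. $\pi_1$ and $\pi_2$ are disjoint, i.e. no non-zero sub-spectral measure of $\pi_1$ is unitarily equivalent to any sub-spectral measure of $\pi_2$. 3. If $T\in\mathcal B(\mathcal H_1,\mathcal H_2)$ satisfies $T\pi_1(A)=\pi_2(A)T$ for all $A\in\mathcal O(X)$, then $T=0$. -/

import Mathlib

open MeasureTheory

/-- A positive operator valued measure on `X` with values in the bounded operators on `H`: the
value at each measurable set is a positive operator, and for all `h, k` the set function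
`A ↦ ⟪h, μ(A) k⟫` is a complex measure. (As for vector measures, sets which are not measurable are
sent to zero; this is forced by `isComplexMeasure`.) -/
structure POVM (X : Type*) [MeasurableSpace X] (H : Type*) [NormedAddCommGroup H]
    [InnerProductSpace ℂ H] where
  toFun : Set X → H →L[ℂ] H
  isPositive : ∀ A, MeasurableSet A → (toFun A).IsPositive
  isComplexMeasure : ∀ h k : H, ∃ ν : ComplexMeasure X, ∀ A, ν A = inner ℂ h (toFun A k)

namespace POVM

instance {X : Type*} [MeasurableSpace X] {H : Type*} [NormedAddCommGroup H]
    [InnerProductSpace ℂ H] : CoeFun (POVM X H) (fun _ => Set X → H →L[ℂ] H) :=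
  ⟨POVM.toFun⟩

/-- A spectral measure is a normalized projection valued measure: every `μ(A)` is an orthogonal
projection and `μ(X)` is the identity. -/
structure IsSpectral {X : Type*} [MeasurableSpace X] {H : Type*} [NormedAddCommGroup H]
    [InnerProductSpace ℂ H] [CompleteSpace H] (μ : POVM X H) : Prop where
  isProjection : ∀ A, MeasurableSet A → IsStarProjection (μ A)
  normalized : μ Set.univ = ContinuousLinearMap.id ℂ H

/-- `μ` is concentrated on `E` if `μ(A) = μ(A ∩ E)` for all measurable `A`. -/
def ConcentratedOn {X : Type*} [MeasurableSpace X] {H : Type*} [NormedAddCommGroup H]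
    [InnerProductSpace ℂ H] (μ : POVM X H) (E : Set X) : Prop :=
  ∀ A, MeasurableSet A → μ A = μ (A ∩ E)

/-- Two POVMs are mutually singular if they are concentrated on disjoint measurable sets. -/
def MutuallySingular {X : Type*} [MeasurableSpace X]
    {H₁ : Type*} [NormedAddCommGroup H₁] [InnerProductSpace ℂ H₁]
    {H₂ : Type*} [NormedAddCommGroup H₂] [InnerProductSpace ℂ H₂]
    (μ₁ : POVM X H₁) (μ₂ : POVM X H₂) : Prop :=
  ∃ X₁ X₂ : Set X, MeasurableSet X₁ ∧ MeasurableSet X₂ ∧ Disjoint X₁ X₂ ∧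
    μ₁.ConcentratedOn X₁ ∧ μ₂.ConcentratedOn X₂

/-- The subspace `K` is invariant under all the operators `μ(A)`. -/
def Invariant {X : Type*} [MeasurableSpace X] {H : Type*} [NormedAddCommGroup H]
    [InnerProductSpace ℂ H] (μ : POVM X H) (K : Submodule ℂ H) : Prop :=
  ∀ A, MeasurableSet A → ∀ x ∈ K, μ A x ∈ K

theorem apply_eq_zero_of_not_measurableSet {X : Type*} [MeasurableSpace X] {H : Type*}
    [NormedAddCommGroup H] [InnerProductSpace ℂ H] (μ : POVM X H) {A : Set X}
    (hA : ¬ MeasurableSet A) : μ A = 0 := by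
  ext k
  obtain ⟨ν, hν⟩ := μ.isComplexMeasure (μ A k) k
  have h := hν A
  rw [ν.not_measurable hA] at h
  exact inner_self_eq_zero.mp h.symm

theorem Invariant.mapsTo {X : Type*} [MeasurableSpace X] {H : Type*} [NormedAddCommGroup H]
    [InnerProductSpace ℂ H] {μ : POVM X H} {K : Submodule ℂ H} (hK : μ.Invariant K) (A : Set X) :
    Set.MapsTo (μ A) K K := by
  intro x hx
  by_cases hA : MeasurableSet A
  · exact hK A hA x hx
  · rw [μ.apply_eq_zero_of_not_measurableSet hA]
    exact K.zero_mem

/-- The restriction `A ↦ μ(A)|_K` of a POVM to an invariant subspace `K`. -/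
def restrict {X : Type*} [MeasurableSpace X] {H : Type*} [NormedAddCommGroup H]
    [InnerProductSpace ℂ H] (μ : POVM X H) (K : Submodule ℂ H) (hK : μ.Invariant K) :
    POVM X K where
  toFun A := (μ A).restrict (hK.mapsTo A)
  isPositive A hA := by
    refine ⟨fun x y => ?_, fun x => ?_⟩
    · exact (μ.isPositive A hA).1 (x : H) (y : H)
    · exact (μ.isPositive A hA).2 (x : H)
  isComplexMeasure h k := μ.isComplexMeasure (h : H) (k : H)

/-- The restriction of a spectral measure to a closed invariant subspace is a spectral measure;
these restrictions are the sub-spectral measures of `π`. -/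
theorem IsSpectral.restrict {X : Type*} [MeasurableSpace X] {H : Type*} [NormedAddCommGroup H]
    [InnerProductSpace ℂ H] [CompleteSpace H] {π : POVM X H} (hπ : π.IsSpectral)
    (K : Submodule ℂ H) [CompleteSpace K] (hK : π.Invariant K) :
    (π.restrict K hK).IsSpectral where
  isProjection A hA := by
    refine ⟨?_, ((π.restrict K hK).isPositive A hA).isSelfAdjoint⟩
    ext x
    exact congrArg (fun S : H →L[ℂ] H => S (x : H)) (hπ.isProjection A hA).isIdempotentElem
  normalized := by
    ext x
    exact congrArg (fun S : H →L[ℂ] H => S (x : H)) hπ.normalized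

/-- Two POVMs on `X` are unitarily equivalent if a unitary operator intertwines them. -/
def UnitarilyEquivalent {X : Type*} [MeasurableSpace X]
    {H₁ : Type*} [NormedAddCommGroup H₁] [InnerProductSpace ℂ H₁]
    {H₂ : Type*} [NormedAddCommGroup H₂] [InnerProductSpace ℂ H₂]
    (μ₁ : POVM X H₁) (μ₂ : POVM X H₂) : Prop :=
  ∃ U : H₁ ≃ₗᵢ[ℂ] H₂, ∀ A, MeasurableSet A → ∀ x : H₁, U (μ₁ A x) = μ₂ A (U x)

/-- `π₁` and `π₂` are disjoint if no non-zero sub-spectral measure of `π₁` (restriction to a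
non-zero closed invariant subspace) is unitarily equivalent to a sub-spectral measure of `π₂`. -/
def DisjointFrom {X : Type*} [MeasurableSpace X]
    {H₁ : Type*} [NormedAddCommGroup H₁] [InnerProductSpace ℂ H₁]
    {H₂ : Type*} [NormedAddCommGroup H₂] [InnerProductSpace ℂ H₂]
    (π₁ : POVM X H₁) (π₂ : POVM X H₂) : Prop :=
  ∀ (K₁ : Submodule ℂ H₁) (K₂ : Submodule ℂ H₂) (hK₁ : π₁.Invariant K₁) (hK₂ : π₂.Invariant K₂),
    IsClosed (K₁ : Set H₁) → IsClosed (K₂ : Set H₂) → K₁ ≠ ⊥ →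
      ¬ UnitarilyEquivalent (π₁.restrict K₁ hK₁) (π₂.restrict K₂ hK₂)

end POVM

open scoped ComplexOrder

/-! The substance is that disjointness forces singularity; it is proved through the scalar measures
`A ↦ ⟪h, π A h⟫`. The cyclic subspace of `h` is a copy of `L²` of its scalar measure, with `π A`
acting as multiplication by the indicator of `A`. So two spectral measures that share a non-zero
scalar measure have equivalent non-zero sub-spectral measures. If scalar measures `μ`, `μ'` of the
two sides are not mutually singular, the absolutely continuous part of `μ` is such a shared measure:
cutting `h` by a projection realises it on one side, the square root of its density realises it on
the other. By separability, countably many scalar measures control each side, and one set separates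
all of them.

The other implications are algebraic: singularity kills an intertwiner since `π A` is the identity
on one side and zero on the other for a suitable `A`, and an equivalence of sub-spectral measures
extends by zero to an intertwiner. -/

/-- Two families with equal Gram matrices, the first of which is total, are related by a linear
isometry. -/
theorem exists_linearIsometry_of_inner_eq {ι E F : Type*} [NormedAddCommGroup E]
    [InnerProductSpace ℂ E] [NormedAddCommGroup F] [InnerProductSpace ℂ F] [CompleteSpace F]
    (v : ι → E) (w : ι → F) (hvw : ∀ i j, inner ℂ (v i) (v j) = inner ℂ (w i) (w j))
    (hv : (Submodule.span ℂ (Set.range v)).topologicalClosure = ⊤) :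
    ∃ V : E →ₗᵢ[ℂ] F, ∀ i, V (v i) = w i := by
  set e := Finsupp.linearCombination ℂ v
  set f := Finsupp.linearCombination ℂ w
  have hd : DenseRange e := by
    have h := Submodule.dense_iff_topologicalClosure_eq_top.mpr hv
    rw [← Finsupp.range_linearCombination] at h
    simpa [DenseRange, LinearMap.coe_range] using h
  have hn : ∀ x, ‖f x‖ = ‖e x‖ := by
    intro x
    have h : inner ℂ (f x) (f x) = inner ℂ (e x) (e x) := by
      simp only [e, f, Finsupp.linearCombination_apply, Finsupp.sum, sum_inner, inner_sum,
        inner_smul_left, inner_smul_right, hvw]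
    rw [inner_self_eq_norm_sq_to_K, inner_self_eq_norm_sq_to_K] at h
    exact (sq_eq_sq₀ (norm_nonneg _) (norm_nonneg _)).mp (by exact_mod_cast h)
  -- This bound makes `e x ↦ f x` well defined, even when `v` is linearly dependent.
  have hC : ∃ C, ∀ x, ‖f x‖ ≤ C * ‖e x‖ := ⟨1, fun x => by rw [hn, one_mul]⟩
  have hfe := LinearMap.extendOfNorm_eq (f := f) (e := e) hd hC
  refine ⟨⟨(f.extendOfNorm e).toLinearMap, fun x => ?_⟩, fun i => ?_⟩
  · change ‖f.extendOfNorm e x‖ = ‖x‖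
    refine hd.induction_on (p := fun x => ‖f.extendOfNorm e x‖ = ‖x‖) x
      (isClosed_eq (by fun_prop) (by fun_prop)) fun a => ?_
    rw [hfe, hn]
  · change f.extendOfNorm e (v i) = w i
    have h := hfe (Finsupp.single i 1)
    simpa [e, f] using h

/-- The indicators of measurable sets are total in `L²` of a finite measure. -/
theorem topologicalClosure_span_indicatorConstLp_eq_top {X : Type*} [MeasurableSpace X]
    (ν : Measure X) [IsFiniteMeasure ν] :
    (Submodule.span ℂ (Set.range fun A : {A : Set X // MeasurableSet A} =>
      indicatorConstLp 2 A.2 (measure_ne_top ν A.1) (1 : ℂ))).topologicalClosure = ⊤ := by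
  rw [eq_top_iff]
  rintro g -
  refine Lp.induction (by norm_num) (motive := fun g => g ∈ (Submodule.span ℂ
    (Set.range fun A : {A : Set X // MeasurableSet A} =>
      indicatorConstLp 2 A.2 (measure_ne_top ν A.1) (1 : ℂ))).topologicalClosure) ?_ ?_ ?_ g
  · intro c s hs hμs
    have h : (Lp.simpleFunc.indicatorConst 2 hs hμs.ne c : Lp ℂ 2 ν) =
        c • indicatorConstLp 2 hs (measure_ne_top ν s) (1 : ℂ) := by
      rw [Lp.simpleFunc.coe_indicatorConst]
      ext1
      filter_upwards [indicatorConstLp_coeFn (p := 2) (hs := hs) (hμs := hμs.ne) (c := c),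
        indicatorConstLp_coeFn (p := 2) (hs := hs) (hμs := measure_ne_top ν s) (c := (1 : ℂ)),
        Lp.coeFn_smul c (indicatorConstLp 2 hs (measure_ne_top ν s) (1 : ℂ))] with x h₁ h₂ h₃
      rw [h₁, h₃, Pi.smul_apply, h₂]
      by_cases hx : x ∈ s <;> simp [hx]
    rw [h]
    exact Submodule.smul_mem _ _ (Submodule.le_topologicalClosure _
      (Submodule.subset_span ⟨⟨s, hs⟩, rfl⟩))
  · intro f g hf hg _ h₁ h₂
    exact Submodule.add_mem _ h₁ h₂
  · exact Submodule.isClosed_topologicalClosure _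

/-- Multiplication by the indicator of a measurable set, as a linear map on `L²`. -/
noncomputable def indicatorLinearMap {X : Type*} [MeasurableSpace X] (ν : Measure X) {A : Set X}
    (hA : MeasurableSet A) : Lp ℂ 2 ν →ₗ[ℂ] Lp ℂ 2 ν where
  toFun g := MemLp.toLp (A.indicator g) ((Lp.memLp g).indicator hA)
  map_add' f g := by
    rw [← MemLp.toLp_add]
    refine MemLp.toLp_congr _ _ ?_
    filter_upwards [Lp.coeFn_add f g] with x hx
    by_cases h : x ∈ A
    · rw [Pi.add_apply, Set.indicator_of_mem h, Set.indicator_of_mem h, Set.indicator_of_mem h, hx,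
        Pi.add_apply]
    · simp [h]
  map_smul' c g := by
    rw [RingHom.id_apply, ← MemLp.toLp_const_smul]
    refine MemLp.toLp_congr _ _ ?_
    filter_upwards [Lp.coeFn_smul c g] with x hx
    by_cases h : x ∈ A
    · rw [Pi.smul_apply, Set.indicator_of_mem h, Set.indicator_of_mem h, hx, Pi.smul_apply]
    · simp [h]

theorem indicatorLinearMap_apply {X : Type*} [MeasurableSpace X] (ν : Measure X) {A : Set X}
    (hA : MeasurableSet A) (g : Lp ℂ 2 ν) :
    indicatorLinearMap ν hA g = MemLp.toLp (A.indicator g) ((Lp.memLp g).indicator hA) :=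
  rfl

theorem coeFn_indicatorLinearMap {X : Type*} [MeasurableSpace X] (ν : Measure X) {A : Set X}
    (hA : MeasurableSet A) (g : Lp ℂ 2 ν) : indicatorLinearMap ν hA g =ᵐ[ν] A.indicator g := by
  rw [indicatorLinearMap_apply]
  exact MemLp.coeFn_toLp _

theorem norm_indicatorLinearMap_le {X : Type*} [MeasurableSpace X] (ν : Measure X) {A : Set X}
    (hA : MeasurableSet A) (g : Lp ℂ 2 ν) : ‖indicatorLinearMap ν hA g‖ ≤ 1 * ‖g‖ := by
  rw [one_mul]
  refine Lp.norm_le_norm_of_ae_le ?_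
  filter_upwards [coeFn_indicatorLinearMap ν hA g] with x hx
  rw [hx]
  exact norm_indicator_le_norm_self _ _

/-- Multiplication by the indicator of a measurable set, as a bounded operator on `L²`. -/
noncomputable def indicatorCLM {X : Type*} [MeasurableSpace X] (ν : Measure X) {A : Set X}
    (hA : MeasurableSet A) : Lp ℂ 2 ν →L[ℂ] Lp ℂ 2 ν :=
  (indicatorLinearMap ν hA).mkContinuous 1 (norm_indicatorLinearMap_le ν hA)

theorem coeFn_indicatorCLM {X : Type*} [MeasurableSpace X] (ν : Measure X) {A : Set X}
    (hA : MeasurableSet A) (g : Lp ℂ 2 ν) : indicatorCLM ν hA g =ᵐ[ν] A.indicator g :=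
  coeFn_indicatorLinearMap ν hA g

/-! ### Scalar measures and multiplicativity of spectral measures -/

namespace POVM

variable {X : Type*} [MeasurableSpace X] {H : Type*} [NormedAddCommGroup H]
  [InnerProductSpace ℂ H]

theorem apply_empty (π : POVM X H) : π ∅ = 0 := by
  ext k
  obtain ⟨ν, hν⟩ := π.isComplexMeasure (π ∅ k) k
  exact inner_self_eq_zero.mp ((hν ∅).symm.trans ν.empty)

theorem apply_union (π : POVM X H) {A B : Set X} (hA : MeasurableSet A) (hB : MeasurableSet B)
    (hAB : Disjoint A B) : π (A ∪ B) = π A + π B := by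
  ext k
  refine ext_inner_left ℂ fun h => ?_
  obtain ⟨ν, hν⟩ := π.isComplexMeasure h k
  rw [add_apply, inner_add_right, ← hν, ← hν, ← hν,
    VectorMeasure.of_union hAB hA hB]

theorem apply_inter_add_diff (π : POVM X H) {A B : Set X} (hA : MeasurableSet A)
    (hB : MeasurableSet B) : π (A ∩ B) + π (A \ B) = π A := by
  rw [← π.apply_union (hA.inter hB) (hA.diff hB) Set.disjoint_sdiff_inter.symm,
    Set.inter_union_sdiff]

theorem inner_apply_left (π : POVM X H) {A : Set X} (hA : MeasurableSet A) (x y : H) :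
    inner ℂ (π A x) y = inner ℂ x (π A y) :=
  (π.isPositive A hA).1 x y

theorem exists_scalarMeasure (π : POVM X H) (h : H) :
    ∃ ν : Measure X, IsFiniteMeasure ν ∧
      ∀ A, MeasurableSet A → ((ν.real A : ℝ) : ℂ) = inner ℂ h (π A h) := by
  obtain ⟨c, hc⟩ := π.isComplexMeasure h h
  have hre : ∀ A, (ComplexMeasure.re c) A = (inner ℂ h (π A h)).re := fun A => by
    rw [← hc]; rfl
  have hpos : ∀ A, MeasurableSet A → 0 ≤ (inner ℂ h (π A h) : ℂ) := fun A hA =>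
    (π.isPositive A hA).inner_nonneg_right h
  have h0 : (0 : SignedMeasure X) ≤[Set.univ] ComplexMeasure.re c := by
    refine VectorMeasure.restrict_le_restrict_of_subset_le _ _ fun A hA _ => ?_
    rw [hre]
    exact (Complex.le_def.mp (hpos A hA)).1
  refine ⟨(ComplexMeasure.re c).toMeasureOfZeroLE Set.univ MeasurableSet.univ h0,
    inferInstance, fun A hA => ?_⟩
  rw [SignedMeasure.toMeasureOfZeroLE_real_apply _ h0 MeasurableSet.univ hA, Set.univ_inter, hre]
  exact Complex.ext rfl (Complex.le_def.mp (hpos A hA)).2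

variable [CompleteSpace H] {π : POVM X H}

/-- Since `P + Q` is idempotent, `P * Q + Q * P = 0`. Multiplying by `P` on either side gives `P * Q
= -P * Q * P = Q * P`, hence `2 • (P * Q) = 0`. -/
theorem IsSpectral.comp_eq_zero (hπ : π.IsSpectral) {A B : Set X} (hA : MeasurableSet A)
    (hB : MeasurableSet B) (hAB : Disjoint A B) : π A * π B = 0 := by
  have hP := (hπ.isProjection A hA).isIdempotentElem.eq
  have hQ := (hπ.isProjection B hB).isIdempotentElem.eq
  have hR := (hπ.isProjection _ (hA.union hB)).isIdempotentElem.eq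
  rw [π.apply_union hA hB hAB] at hR
  generalize π A = P at *
  generalize π B = Q at *
  have h : P * Q + Q * P = 0 := by
    have : (P + Q) * (P + Q) = P * P + Q * Q + (P * Q + Q * P) := by noncomm_ring
    rw [this, hP, hQ] at hR
    simpa using hR
  have h₁ : P * Q + P * Q * P = 0 := by
    have := congrArg (P * ·) h
    simpa [mul_add, ← mul_assoc, hP] using this
  have h₂ : P * Q * P + Q * P = 0 := by
    have := congrArg (· * P) h
    simpa [add_mul, mul_assoc, hP] using this
  have h₃ : (2 : ℂ) • (P * Q) = 0 := by
    rw [two_smul]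
    have : P * Q + P * Q = (P * Q + P * Q * P) - (P * Q * P + Q * P) + (P * Q + Q * P) := by abel
    rw [this, h, h₁, h₂]; simp
  simpa using h₃

theorem IsSpectral.apply_mul_apply (hπ : π.IsSpectral) {A B : Set X} (hA : MeasurableSet A)
    (hB : MeasurableSet B) : π A * π B = π (A ∩ B) := by
  have hd : Disjoint (A \ B) B := Set.disjoint_sdiff_left
  have hd' : Disjoint (A ∩ B) (B \ A) :=
    Set.disjoint_sdiff_right.mono_left Set.inter_subset_left
  have h1 : π (A ∩ B) * π B = π (A ∩ B) := by
    rw [← π.apply_inter_add_diff hB hA, mul_add, Set.inter_comm B A,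
      hπ.comp_eq_zero (hA.inter hB) (hB.diff hA) hd', add_zero]
    exact (hπ.isProjection _ (hA.inter hB)).isIdempotentElem.eq
  rw [← π.apply_inter_add_diff hA hB, add_mul, h1, hπ.comp_eq_zero (hA.diff hB) hB hd, add_zero]

theorem IsSpectral.apply_apply (hπ : π.IsSpectral) {A B : Set X} (hA : MeasurableSet A)
    (hB : MeasurableSet B) (x : H) : π A (π B x) = π (A ∩ B) x :=
  congrArg (fun S : H →L[ℂ] H => S x) (hπ.apply_mul_apply hA hB)

theorem IsSpectral.concentratedOn_of_apply_compl_eq_zero (hπ : π.IsSpectral) {E : Set X}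
    (hE : MeasurableSet E) (h : π Eᶜ = 0) : π.ConcentratedOn E := by
  intro A hA
  rw [← π.apply_inter_add_diff hA hE, Set.sdiff_eq, ← hπ.apply_mul_apply hA hE.compl, h]
  simp

end POVM

theorem indicatorCLM_indicatorConstLp {X : Type*} [MeasurableSpace X] (ν : Measure X)
    [IsFiniteMeasure ν] {A B : Set X} (hA : MeasurableSet A) (hB : MeasurableSet B) :
    indicatorCLM ν hA (indicatorConstLp 2 hB (measure_ne_top ν B) 1) =
      indicatorConstLp 2 (hA.inter hB) (measure_ne_top ν _) 1 := by
  ext1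
  filter_upwards [coeFn_indicatorCLM ν hA (indicatorConstLp 2 hB (measure_ne_top ν B) 1),
    indicatorConstLp_coeFn (p := 2) (hs := hB) (hμs := measure_ne_top ν B) (c := (1 : ℂ)),
    indicatorConstLp_coeFn (p := 2) (hs := hA.inter hB) (hμs := measure_ne_top ν _)
      (c := (1 : ℂ))] with x h₁ h₂ h₃
  rw [h₁, h₃, ← Set.indicator_indicator]
  by_cases hx : x ∈ A <;> simp [hx, h₂]

/-! ### Cyclic subspaces and the equivalence -/

namespace POVM

variable {X : Type*} [MeasurableSpace X] {H : Type*} [NormedAddCommGroup H]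
  [InnerProductSpace ℂ H] [CompleteSpace H] {π : POVM X H}

/-- The cyclic representation: `L²` of the scalar measure of `h` embeds isometrically in `H`,
the spectral measure acting by multiplication with indicators. -/
theorem IsSpectral.exists_linearIsometry (hπ : π.IsSpectral) (h : H) (ν : Measure X)
    [IsFiniteMeasure ν]
    (hν : ∀ A, MeasurableSet A → ((ν.real A : ℝ) : ℂ) = inner ℂ h (π A h)) :
    ∃ V : Lp ℂ 2 ν →ₗᵢ[ℂ] H,
      V (indicatorConstLp 2 MeasurableSet.univ (measure_ne_top ν _) 1) = h ∧
      ∀ A (hA : MeasurableSet A) g, π A (V g) = V (indicatorCLM ν hA g) := by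
  obtain ⟨V, hV⟩ := exists_linearIsometry_of_inner_eq
    (fun A : {A : Set X // MeasurableSet A} =>
      indicatorConstLp 2 A.2 (measure_ne_top ν A.1) (1 : ℂ)) (fun A => π A.1 h)
    (fun A B => by
      rw [L2.inner_indicatorConstLp_one_indicatorConstLp_one, π.inner_apply_left A.2,
        hπ.apply_apply A.2 B.2, ← hν _ (A.2.inter B.2)]
      rfl)
    (topologicalClosure_span_indicatorConstLp_eq_top ν)
  refine ⟨V, ?_, fun A hA g => ?_⟩
  · rw [hV ⟨Set.univ, MeasurableSet.univ⟩, hπ.normalized]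
    rfl
  · have hd := Submodule.dense_iff_topologicalClosure_eq_top.mpr
      (topologicalClosure_span_indicatorConstLp_eq_top ν)
    have : π A ∘L V.toContinuousLinearMap = V.toContinuousLinearMap ∘L indicatorCLM ν hA := by
      refine ContinuousLinearMap.ext_on hd ?_
      rintro _ ⟨B, rfl⟩
      change π A (V _) = V (indicatorCLM ν hA _)
      rw [indicatorCLM_indicatorConstLp ν hA B.2, hV B, hV ⟨A ∩ B.1, hA.inter B.2⟩,
        hπ.apply_apply hA B.2]
    exact congrArg (fun S : Lp ℂ 2 ν →L[ℂ] H => S g) this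

/-- If `ν` has a density with respect to the scalar measure `μ` of `k`, then `ν` is the scalar
measure of some vector. -/
theorem IsSpectral.exists_scalarMeasure_withDensity (hπ : π.IsSpectral) (k : H) (μ : Measure X)
    [IsFiniteMeasure μ] (hμ : ∀ A, MeasurableSet A → ((μ.real A : ℝ) : ℂ) = inner ℂ k (π A k))
    (f : X → ENNReal) (hf : Measurable f) [IsFiniteMeasure (μ.withDensity f)] :
    ∃ k' : H, ∀ A, MeasurableSet A →
      (((μ.withDensity f).real A : ℝ) : ℂ) = inner ℂ k' (π A k') := by
  obtain ⟨V, -, hV⟩ := hπ.exists_linearIsometry k μ hμ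
  have hfi : ∫⁻ x, f x ∂μ ≠ ⊤ := by
    have := measure_ne_top (μ.withDensity f) Set.univ
    rwa [withDensity_apply _ MeasurableSet.univ, Measure.restrict_univ] at this
  have hint : Integrable (fun x => (f x).toReal) μ :=
    integrable_toReal_of_lintegral_ne_top hf.aemeasurable hfi
  -- The vector is the image of `√f`, because `⟪√f, 1_A √f⟫` is the integral of `f` over `A`.
  -- Passing to `toReal` is harmless: `f` is finite almost everywhere.
  set r : X → ℂ := fun x => (Real.sqrt (f x).toReal : ℝ) with hr
  have hrm : Measurable r := by fun_prop
  have hrn : ∀ x, ‖r x‖ ^ 2 = (f x).toReal := fun x => by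
    rw [hr, Complex.norm_real, Real.norm_eq_abs, sq_abs, Real.sq_sqrt ENNReal.toReal_nonneg]
  have hrL : MemLp r 2 μ := by
    rw [memLp_two_iff_integrable_sq_norm hrm.aestronglyMeasurable]
    simpa only [hrn] using hint
  refine ⟨V (hrL.toLp r), fun A hA => ?_⟩
  rw [hV A hA, V.inner_map_map, L2.inner_def]
  have hae : (fun x => inner ℂ (hrL.toLp r x) (indicatorCLM μ hA (hrL.toLp r) x)) =ᵐ[μ]
      A.indicator fun x => (((f x).toReal : ℝ) : ℂ) := by
    filter_upwards [coeFn_indicatorCLM μ hA (hrL.toLp r), hrL.coeFn_toLp] with x h₁ h₂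
    rw [h₁]
    by_cases hx : x ∈ A
    · rw [Set.indicator_of_mem hx, Set.indicator_of_mem hx, h₂, inner_self_eq_norm_sq_to_K]
      exact (Complex.ofReal_pow _ 2).symm.trans (congrArg Complex.ofReal (hrn x))
    · simp [hx]
  rw [integral_congr_ae hae, integral_indicator hA, integral_complex_ofReal,
    integral_toReal hf.aemeasurable (ae_restrict_of_ae (ae_lt_top hf hfi)), Measure.real,
    withDensity_apply _ hA]

omit [CompleteSpace H] in
theorem invariant_range_of_intertwining (π : POVM X H) (ν : Measure X) (V : Lp ℂ 2 ν →ₗᵢ[ℂ] H)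
    (hV : ∀ A (hA : MeasurableSet A) g, π A (V g) = V (indicatorCLM ν hA g)) :
    π.Invariant (LinearMap.range V.toLinearMap) := by
  rintro A hA _ ⟨g, rfl⟩
  exact ⟨indicatorCLM ν hA g, (hV A hA g).symm⟩

variable {H' : Type*} [NormedAddCommGroup H'] [InnerProductSpace ℂ H'] [CompleteSpace H']
  {π' : POVM X H'}

/-- Spectral measures which share a non-zero scalar measure are not disjoint. -/
theorem IsSpectral.not_disjointFrom_of_scalarMeasure (hπ : π.IsSpectral) (hπ' : π'.IsSpectral)
    (h : H) (h' : H') (ν : Measure X) [IsFiniteMeasure ν] (hν0 : ν ≠ 0)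
    (hν : ∀ A, MeasurableSet A → ((ν.real A : ℝ) : ℂ) = inner ℂ h (π A h))
    (hν' : ∀ A, MeasurableSet A → ((ν.real A : ℝ) : ℂ) = inner ℂ h' (π' A h')) :
    ¬ π.DisjointFrom π' := by
  intro hdis
  obtain ⟨V, hVh, hV⟩ := hπ.exists_linearIsometry h ν hν
  obtain ⟨V', -, hV'⟩ := hπ'.exists_linearIsometry h' ν hν'
  refine hdis (LinearMap.range V.toLinearMap) (LinearMap.range V'.toLinearMap)
    (invariant_range_of_intertwining π ν V hV) (invariant_range_of_intertwining π' ν V' hV')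
    (LinearMap.coe_range V.toLinearMap ▸ V.isometry.isClosedEmbedding.isClosed_range)
    (LinearMap.coe_range V'.toLinearMap ▸ V'.isometry.isClosedEmbedding.isClosed_range) ?_ ?_
  · intro hbot
    have hh : h = 0 := by
      have : h ∈ LinearMap.range V.toLinearMap := ⟨_, hVh⟩
      rwa [hbot, Submodule.mem_bot] at this
    have := hν Set.univ MeasurableSet.univ
    rw [hh, inner_zero_left] at this
    exact hν0 (Measure.measure_univ_eq_zero.mp
      ((measureReal_eq_zero_iff (measure_ne_top ν _)).mp (by exact_mod_cast this)))
  · refine ⟨V.equivRange.symm.trans V'.equivRange, fun A hA => ?_⟩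
    intro x
    obtain ⟨g, rfl⟩ := V.equivRange.surjective x
    have hx : (π.restrict _ (invariant_range_of_intertwining π ν V hV)) A (V.equivRange g) =
        V.equivRange (indicatorCLM ν hA g) := Subtype.ext (hV A hA g)
    rw [hx, LinearIsometryEquiv.trans_apply, LinearIsometryEquiv.trans_apply,
      LinearIsometryEquiv.symm_apply_apply, LinearIsometryEquiv.symm_apply_apply]
    exact Subtype.ext (hV' A hA g).symm

theorem IsSpectral.scalarMeasure_restrict (hπ : π.IsSpectral) (h : H) (μ : Measure X)
    (hμ : ∀ A, MeasurableSet A → ((μ.real A : ℝ) : ℂ) = inner ℂ h (π A h)) {S : Set X}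
    (hS : MeasurableSet S) (A : Set X) (hA : MeasurableSet A) :
    (((μ.restrict S).real A : ℝ) : ℂ) = inner ℂ (π S h) (π A (π S h)) := by
  rw [measureReal_restrict_apply hA, hμ _ (hA.inter hS), π.inner_apply_left hS,
    hπ.apply_apply hA hS, hπ.apply_apply hS (hA.inter hS), Set.inter_eq_right.mpr
      Set.inter_subset_right]

/-- The scalar measures of disjoint spectral measures are mutually singular. -/
theorem IsSpectral.mutuallySingular_scalarMeasure (hπ : π.IsSpectral) (hπ' : π'.IsSpectral)
    (hdis : π.DisjointFrom π') (h : H) (h' : H') (μ μ' : Measure X) [IsFiniteMeasure μ]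
    [IsFiniteMeasure μ']
    (hμ : ∀ A, MeasurableSet A → ((μ.real A : ℝ) : ℂ) = inner ℂ h (π A h))
    (hμ' : ∀ A, MeasurableSet A → ((μ'.real A : ℝ) : ℂ) = inner ℂ h' (π' A h')) :
    μ ⟂ₘ μ' := by
  -- The singular part vanishes on `S` and `μ'` off `S`, so restricting `μ` to `S` leaves exactly
  -- the absolutely continuous part, which is the scalar measure of `π S h`.
  obtain ⟨S, hS, hS₁, hS₂⟩ := Measure.mutuallySingular_singularPart μ μ'
  have hdec := Measure.haveLebesgueDecomposition_add μ μ'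
  have hres : μ.restrict S = μ'.withDensity (μ.rnDeriv μ') := by
    have h₁ : (μ'.withDensity (μ.rnDeriv μ')).restrict S = μ'.withDensity (μ.rnDeriv μ') := by
      refine Measure.restrict_eq_self_of_ae_mem ?_
      exact (withDensity_absolutelyContinuous μ' _).ae_le (mem_ae_iff.mpr hS₂)
    have := congrArg (fun m : Measure X => m.restrict S) hdec
    simpa only [Measure.restrict_add, Measure.restrict_eq_zero.mpr hS₁, zero_add, h₁] using this
  by_cases h0 : μ'.withDensity (μ.rnDeriv μ') = 0
  · rw [h0, add_zero] at hdec
    rw [hdec]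
    exact Measure.mutuallySingular_singularPart μ μ'
  · obtain ⟨k, hk⟩ := hπ'.exists_scalarMeasure_withDensity h' μ' hμ' _
      (Measure.measurable_rnDeriv μ μ')
    refine absurd hdis (hπ.not_disjointFrom_of_scalarMeasure hπ' (π S h) k _ h0 ?_ hk)
    rw [← hres]
    exact fun A hA => hπ.scalarMeasure_restrict h μ hμ hS A hA

theorem IsSpectral.apply_eq_zero_of_scalarMeasure (hπ : π.IsSpectral) (h : H) (μ : Measure X)
    (hμ : ∀ A, MeasurableSet A → ((μ.real A : ℝ) : ℂ) = inner ℂ h (π A h)) {A : Set X}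
    (hA : MeasurableSet A) (h0 : μ A = 0) : π A h = 0 := by
  rw [← inner_self_eq_zero (𝕜 := ℂ), π.inner_apply_left hA, hπ.apply_apply hA hA, Set.inter_self,
    ← hμ A hA, Measure.real, h0]
  simp

/-- A null set of every scalar measure in the family kills a dense set of vectors, since `‖π A h‖²`
is the scalar measure of `A`; continuity does the rest. -/
theorem IsSpectral.apply_eq_zero_of_dense (hπ : π.IsSpectral) {ι : Type*} (u : ι → H)
    (hu : DenseRange u) (μ : ι → Measure X)
    (hμ : ∀ i A, MeasurableSet A → (((μ i).real A : ℝ) : ℂ) = inner ℂ (u i) (π A (u i)))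
    {A : Set X} (hA : MeasurableSet A) (h0 : Measure.sum μ A = 0) : π A = 0 := by
  rw [Measure.sum_apply_eq_zero' hA] at h0
  refine ContinuousLinearMap.ext fun x => ?_
  exact hu.induction_on (p := fun x => π A x = 0) x (isClosed_eq (by fun_prop) continuous_const)
    fun i => hπ.apply_eq_zero_of_scalarMeasure (u i) (μ i) (hμ i) hA (h0 i)

theorem IsSpectral.mutuallySingular_of_disjointFrom [TopologicalSpace.SeparableSpace H]
    [TopologicalSpace.SeparableSpace H'] (hπ : π.IsSpectral) (hπ' : π'.IsSpectral)
    (hdis : π.DisjointFrom π') : π.MutuallySingular π' := by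
  choose μ hfin hμ using fun n => π.exists_scalarMeasure (TopologicalSpace.denseSeq H n)
  choose μ' hfin' hμ' using fun n => π'.exists_scalarMeasure (TopologicalSpace.denseSeq H' n)
  -- Pairwise singularity passes to countable sums, which yields a single separating set.
  have hsing : Measure.sum μ ⟂ₘ Measure.sum μ' := by
    rw [Measure.MutuallySingular.sum_left]
    intro i
    rw [Measure.MutuallySingular.sum_right]
    exact fun j => hπ.mutuallySingular_scalarMeasure hπ' hdis _ _ _ _ (hμ i) (hμ' j)
  obtain ⟨S, hS, h₁, h₂⟩ := hsing
  refine ⟨Sᶜ, S, hS.compl, hS, disjoint_compl_left,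
    hπ.concentratedOn_of_apply_compl_eq_zero hS.compl ?_,
    hπ'.concentratedOn_of_apply_compl_eq_zero hS ?_⟩
  · rw [compl_compl]
    exact hπ.apply_eq_zero_of_dense _ (TopologicalSpace.denseRange_denseSeq H) μ hμ hS h₁
  · exact hπ'.apply_eq_zero_of_dense _ (TopologicalSpace.denseRange_denseSeq H') μ' hμ' hS.compl h₂

omit [CompleteSpace H'] in
theorem IsSpectral.eq_zero_of_intertwines (hπ : π.IsSpectral)
    (hs : π.MutuallySingular π') (T : H →L[ℂ] H')
    (hT : ∀ A, MeasurableSet A → T ∘L π A = π' A ∘L T) : T = 0 := by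
  obtain ⟨X₁, X₂, h₁, -, hd, hc, hc'⟩ := hs
  have h := hT X₁ h₁
  -- `π' X₁ = π' (X₁ ∩ X₂) = 0`, while `π X₁ = π univ` is the identity.
  rw [hc' X₁ h₁, hd.inter_eq, π'.apply_empty, ContinuousLinearMap.zero_comp] at h
  rwa [← Set.univ_inter X₁, ← hc _ MeasurableSet.univ, hπ.normalized,
    ContinuousLinearMap.comp_id] at h

omit [CompleteSpace H] in
/-- The orthogonal projection onto an invariant subspace commutes with the POVM. -/
theorem Invariant.orthogonalProjection_apply {K : Submodule ℂ H} [K.HasOrthogonalProjection]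
    (hK : π.Invariant K) {A : Set X} (hA : MeasurableSet A) (x : H) :
    K.orthogonalProjectionOnto (π A x) = π.restrict K hK A (K.orthogonalProjectionOnto x) := by
  refine Subtype.ext ?_
  refine (Submodule.eq_starProjection_of_mem_of_inner_eq_zero
    (v := π A (K.orthogonalProjectionOnto x)) (hK A hA _ (Subtype.coe_prop _)) fun w hw => ?_)
  rw [← map_sub, π.inner_apply_left hA]
  exact Submodule.starProjection_inner_eq_zero x _ (hK A hA w hw)

omit [CompleteSpace H'] in
theorem disjointFrom_of_forall_intertwiner_eq_zero (hT : ∀ T : H →L[ℂ] H',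
    (∀ A, MeasurableSet A → T ∘L π A = π' A ∘L T) → T = 0) : π.DisjointFrom π' := by
  rintro K K' hK hK' hc - hne ⟨U, hU⟩
  have : CompleteSpace K := hc.completeSpace_coe
  -- Project onto `K`, apply `U`, include `K'`: this intertwiner agrees with the injective `U` on
  -- `K`, so its vanishing forces `K = ⊥`.
  have h := hT (K'.subtypeL ∘L (U.toContinuousLinearEquiv : K →L[ℂ] K') ∘L
    K.orthogonalProjectionOnto) fun A hA => ContinuousLinearMap.ext fun x => by
      change ((U (K.orthogonalProjectionOnto (π A x)) : K') : H') =
        π' A (U (K.orthogonalProjectionOnto x) : K')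
      rw [hK.orthogonalProjection_apply hA, hU A hA]
      rfl
  refine hne (K.eq_bot_iff.mpr fun x hx => ?_)
  have hx' : ((U (K.orthogonalProjectionOnto x) : K') : H') = 0 :=
    congrArg (fun S : H →L[ℂ] H' => S x) h
  rw [ZeroMemClass.coe_eq_zero, U.map_eq_zero_iff] at hx'
  rw [← Submodule.starProjection_eq_self_iff.mpr hx, Submodule.starProjection_apply, hx']
  rfl

end POVM

theorem mainTheorem8 {X : Type*} [MeasurableSpace X]
    {H₁ : Type*} [NormedAddCommGroup H₁] [InnerProductSpace ℂ H₁] [CompleteSpace H₁]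
    [TopologicalSpace.SeparableSpace H₁]
    {H₂ : Type*} [NormedAddCommGroup H₂] [InnerProductSpace ℂ H₂] [CompleteSpace H₂]
    [TopologicalSpace.SeparableSpace H₂]
    (π₁ : POVM X H₁) (π₂ : POVM X H₂) (hπ₁ : π₁.IsSpectral) (hπ₂ : π₂.IsSpectral) :
    List.TFAE [
      POVM.MutuallySingular π₁ π₂,
      POVM.DisjointFrom π₁ π₂,
      ∀ T : H₁ →L[ℂ] H₂,
        (∀ A, MeasurableSet A → T ∘L π₁ A = π₂ A ∘L T) → T = 0] := by
  tfae_have 1 → 3 := hπ₁.eq_zero_of_intertwines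
  tfae_have 3 → 2 := POVM.disjointFrom_of_forall_intertwiner_eq_zero
  tfae_have 2 → 1 := hπ₁.mutuallySingular_of_disjointFrom hπ₂
  tfae_finish
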